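/- Let $X$ and $Y$ be countable sets (finite or empty allowed), let $(\Omega,\mathfrak B,\mu)$ be a probability space, and let $\varphi_\omega\colon X\times Y\to[0,1]$ ($\omega\in\Omega$) be a family of functions such that $\omega\mapsto\varphi_\omega(x,y)$ is measurable for all $(x,y)\in X\times Y$. Put $\mathbb E[\varphi](x,y)=\int_\Omega\varphi_\omega(x,y)\,d\mu(\omega)$. *Notation.* For $\psi\colon X\times Y\to[0,1]$ let $\psi^Y=\{\psi(\cdot,y):y\in Y\}\subseteq[0,1]^X$ and $\psi_X=\{\psi(x,\cdot):x\in X\}\subseteq[0,1]^Y$. For a bounded set $A\subseteq\mathbb R^n$ let $h_A(u)=\sup_{a\in A}\langle a,u\rangle$ and let $w_G(A)=\mathbb E[h_A(G_n)+h_A(-G_n)]$ be its Gaussian mean width, where $G_n\sim N(0,I_n)$. For $Q\subseteq[0,1]^X$ and $n\in\mathbb N$ let $$g_Q(n)=\sup\bigl\{w_G\bigl(\{(q(x_0),\dots,q(x_{n-1})):q\in Q\}\bigr):(x_0,\dots,x_{n-1})\in X^n\bigr\}$$ (suprema over the empty set are taken to be $0$). For $0\le r<s\le1$ and a finite $F\subseteq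 X$, say that $q\in Q$ determines the subset $D\subseteq F$ between $r$ and $s$ if $q(x)\ge s$ for $x\in D$ and $q(x)\le r$ for $x\in F\setminus D$. Let $VC(Q_{r,s})$ be the least $d\in\mathbb N$ such that for no $F\subseteq X$ with $|F|=d$ all $2^d$ subsets of $F$ are determined between $r$ and $s$ by members of $Q$, and $VC(Q_{r,s})=\infty$ if there is no such $d$. The set $Q$ is a *Vapnik-Chervonenkis class* if $VC(Q_{r,s})<\infty$ for all $0\le r<s\le1$. A function $\psi\colon X\times Y\to[0,1]$ is *dependent* if $\psi^Y$ and $\psi_X$ are Vapnik-Chervonenkis classes (these two conditions are equivalent). The family $(\varphi_\omega)_{\omega\in\Omega}$ is *uniformly dependent* if for every $\varepsilon>0$ there is $d\in\mathbb N$ such that $VC\bigl((\varphi_\omega^Y)_{r,r+\varepsilon}\bigr)\le d$ for all $r\in[0,1-\varepsilon]$ and all $\omega\in\Omega$. **Theorem.** For every $n\in\mathbb N$ the function $\omega\mapsto g_{\varphi_\omega^Y}(n)$ is measurable and integrable, and $$g_{\mathbb E[\varphi]^Y}(n)\le\mathbb E\bigl[g_{\varphi_\omega^Y}(n)\bigr].$$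 Consequently, if the family $(\varphi_\omega)_{\omega\in\Omega}$ is uniformly dependent, then $\mathbb E[\varphi]$ is dependent. -/

import Mathlib

open MeasureTheory ProbabilityTheory
open scoped unitInterval Matrix

namespace RandomVC

/-! ### Fuzzy subsets and Vapnik-Chervonenkis classes -/

/-- A fuzzy subset of `X`: some points are known to belong to it, some are known not to belong
to it, and membership of the remaining points is undetermined. -/
structure FuzzySet (X : Type*) where
  pos : Set X
  neg : Set X
  disj : Disjoint pos neg

/-- The collection `𝒞 ∩ F` of all subsets of the finite set `F` that are determined by some
member of `𝒞`. -/
def trace {X : Type*} (𝒞 : Set (FuzzySet X)) (F : Finset X) : Set (Set X) :=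
  {D | ∃ C ∈ 𝒞, (∀ x ∈ F, x ∈ C.pos ∨ x ∈ C.neg) ∧ D = C.pos ∩ (F : Set X)}

/-- The shatter function `f_𝒞(n) = max {|𝒞 ∩ F| : F ⊆ X, |F| = n}`
(equal to `0` if `X` has no subset of size `n`). -/
noncomputable def shatter {X : Type*} (𝒞 : Set (FuzzySet X)) (n : ℕ) : ℕ∞ :=
  ⨆ (F : Finset X) (_ : F.card = n), (trace 𝒞 F).encard

/-- The Vapnik-Chervonenkis index: the least `d` with `f_𝒞(d) < 2 ^ d`, and `⊤` if there is
no such `d`. -/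
noncomputable def vcIndex {X : Type*} (𝒞 : Set (FuzzySet X)) : ℕ∞ :=
  ⨅ (d : ℕ) (_ : shatter 𝒞 d < 2 ^ d), (d : ℕ∞)

/-- The fuzzy set `q_{r,s}`: the points with `q x ≥ s` are in, those with `q x ≤ r` are out. -/
def levelSet {X : Type*} (q : X → I) (r s : ℝ) (hrs : r < s) : FuzzySet X where
  pos := {x | s ≤ (q x : ℝ)}
  neg := {x | (q x : ℝ) ≤ r}
  disj := Set.disjoint_left.mpr fun _ hs hr => absurd (le_trans hs hr) (not_le.mpr hrs)

/-- The class `Q_{r,s} = {q_{r,s} : q ∈ Q}`. -/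
def levelClass {X : Type*} (Q : Set (X → I)) (r s : ℝ) (hrs : r < s) : Set (FuzzySet X) :=
  (fun q => levelSet q r s hrs) '' Q

/-- `Q ⊆ [0,1]^X` is a Vapnik-Chervonenkis class if every `Q_{r,s}`, `0 ≤ r < s ≤ 1`, has finite
index. -/
def IsVCClass {X : Type*} (Q : Set (X → I)) : Prop :=
  ∀ (r s : ℝ) (hrs : r < s), 0 ≤ r → s ≤ 1 → vcIndex (levelClass Q r s hrs) < ⊤

/-! ### Gaussian mean width -/

/-- The support function `h_A(u) = sup {⟨x, u⟩ : x ∈ A}` of a bounded set `A ⊆ ℝⁿ`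
(with `h_∅ = 0`). -/
noncomputable def supportFun {n : ℕ} (A : Set (Fin n → ℝ)) (u : Fin n → ℝ) : ℝ :=
  sSup ((fun x => x ⬝ᵥ u) '' A)

/-- The width `h_A(u) + h_A(-u)` of `A` in the direction `u`. -/
noncomputable def width {n : ℕ} (A : Set (Fin n → ℝ)) (u : Fin n → ℝ) : ℝ :=
  supportFun A u + supportFun A (-u)

/-- The Gaussian mean width `w_G(A) = 𝔼[w(A, G_n)]`, where `G_n` has independent standard normal
coordinates. A bounded set and its closed convex hull have the same support function, hence the
same Gaussian mean width. -/
noncomputable def gaussianMeanWidth {n : ℕ} (A : Set (Fin n → ℝ)) : ℝ :=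
  ∫ u, width A u ∂(Measure.pi fun _ : Fin n => gaussianReal 0 1)

/-- The set `Q(x̄) = {(q x₀, …, q xₙ₋₁) : q ∈ Q} ⊆ [0,1]ⁿ`. -/
def evalSet {X : Type*} (Q : Set (X → I)) {n : ℕ} (x : Fin n → X) : Set (Fin n → ℝ) :=
  (fun q i => (q (x i) : ℝ)) '' Q

/-- `g_Q(n) = sup {w_G(Q(x̄)) : x̄ ∈ Xⁿ}`. The supremum is over a bounded set of nonnegative reals
since `Q(x̄) ⊆ [0,1]ⁿ` (and it is `0` if `Xⁿ` is empty). -/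
noncomputable def widthGrowth {X : Type*} (Q : Set (X → I)) (n : ℕ) : ℝ :=
  ⨆ x : Fin n → X, gaussianMeanWidth (evalSet Q x)

/-! ### Dependent functions and random families -/

/-- `φ^Y = {φ(·, y) : y ∈ Y} ⊆ [0,1]^X`. -/
def colFamily {X Y : Type*} (φ : X → Y → I) : Set (X → I) :=
  Set.range fun (y : Y) (x : X) => φ x y

/-- `φ_X = {φ(x, ·) : x ∈ X} ⊆ [0,1]^Y`. -/
def rowFamily {X Y : Type*} (φ : X → Y → I) : Set (Y → I) :=
  Set.range φ

/-- `φ` is dependent if the families `φ^Y` and `φ_X` are Vapnik-Chervonenkis classes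
(either one of the two conditions implies the other). -/
def IsDependent {X Y : Type*} (φ : X → Y → I) : Prop :=
  IsVCClass (colFamily φ) ∧ IsVCClass (rowFamily φ)

/-- The family `(φ_ω)` is uniformly dependent: for every `ε > 0` there is `d` bounding the index
of `(φ_ω^Y)_{r,r+ε}` for all `r ∈ [0, 1-ε]` and all `ω`. -/
def UniformlyDependent {Ω X Y : Type*} (φ : Ω → X → Y → I) : Prop :=
  ∀ (ε : ℝ) (hε : 0 < ε), ∃ d : ℕ, ∀ r : ℝ, 0 ≤ r → r ≤ 1 - ε → ∀ ω : Ω,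
    vcIndex (levelClass (colFamily (φ ω)) r (r + ε) (lt_add_of_pos_right r hε)) ≤ d

/-- The expectation `𝔼[φ](x, y) = 𝔼[φ(x, y)]` of a random family of `[0,1]`-valued functions. -/
noncomputable def expectation {Ω X Y : Type*} [MeasurableSpace Ω] (μ : Measure Ω)
    [IsProbabilityMeasure μ] (φ : Ω → X → Y → I) (x : X) (y : Y) : I :=
  ⟨∫ ω, (φ ω x y : ℝ) ∂μ, integral_nonneg fun ω => (φ ω x y).2.1, by
    have h : ∫ ω, (φ ω x y : ℝ) ∂μ ≤ ∫ _ω, (1 : ℝ) ∂μ :=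
      integral_mono_of_nonneg (ae_of_all _ fun ω => (φ ω x y).2.1) (integrable_const _)
        (ae_of_all _ fun ω => (φ ω x y).2.2)
    simpa using h⟩

end RandomVC

/-!
The support function `h_A(u)` is a supremum of linear functions of the points of `A`, hence convex,
so `h` of the expectation is at most the expectation of `h` (`supportFun_expectation_le`).
Integrating over `u` and exchanging the two integrals gives the inequality for Gaussian mean widths
(`widthGrowth_expectation_le`). All suprema are over countable sets, which yields measurability, and
`|h_A(u)| ≤ ‖u‖₁` for `A ⊆ [0,1]ⁿ` yields integrability.

For the statement on dependence, let `m` be the first absolute moment of a standard Gaussian. The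
growth of the mean width detects shattering in both directions.

* If arbitrarily large sets are shattered between `r` and `s`, then `g(n) ≥ (s - r) m n` for all
  `n` (`le_widthGrowth_of_shatters`).
* If `φ` is uniformly dependent, then for each `δ > 0` there is `n > 0` with `g(n) ≤ δ n` for all
  `ω` (`UniformlyDependent.exists_widthGrowth_le`). To see this, regard a column restricted to `n`
  points as a fuzzy subset of the grid `{0, …, n - 1} × {0, …, K - 1}` of points and levels.
  A Sauer-Shelah lemma for fuzzy sets (`card_lt_of_not_shatters`) says that a pairwise separated
  family on `N` points that shatters no set of size `D` has at most `N ^ O(D log N)` members. It is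
  proved by splitting the family at a point that many members contain and many exclude. A maximal
  separated family of columns is therefore a `2 / K`-net of size `exp (o(n))` in the sup norm
  (`exists_net_colFamily`), and the usual bound for the expected maximum of Gaussian variables
  applies (`gaussianMeanWidth_le_of_net`).

Since `g` of the expectation is at most the expectation of `g`, the columns of the expectation
form a Vapnik-Chervonenkis class. The rows do so too, by duality (`IsVCClass.rowFamily`).
-/

namespace RandomVC

/-! ### Shattering by fuzzy sets -/

/-- The class `𝒞` shatters the finite set `F` if every subset of `F` is determined by a member
of `𝒞`. -/
def Shatters {X : Type*} (𝒞 : Set (FuzzySet X)) (F : Finset X) : Prop :=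
  ∀ D ⊆ F, ∃ C ∈ 𝒞, (∀ x ∈ D, x ∈ C.pos) ∧ ∀ x ∈ F, x ∉ D → x ∈ C.neg

theorem FuzzySet.notMem_neg {X : Type*} (C : FuzzySet X) {x : X} (hx : x ∈ C.pos) : x ∉ C.neg :=
  Set.disjoint_left.mp C.disj hx

theorem Shatters.mono {X : Type*} {𝒞 𝒟 : Set (FuzzySet X)} (h𝒞 : 𝒞 ⊆ 𝒟) {F : Finset X}
    (h : Shatters 𝒞 F) : Shatters 𝒟 F := fun D hD =>
  let ⟨C, hC, hC'⟩ := h D hD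
  ⟨C, h𝒞 hC, hC'⟩

theorem Shatters.subset {X : Type*} {𝒞 : Set (FuzzySet X)} {F G : Finset X}
    (h : Shatters 𝒞 F) (hG : G ⊆ F) : Shatters 𝒞 G := fun D hD =>
  let ⟨C, hC, hp, hn⟩ := h D (hD.trans hG)
  ⟨C, hC, hp, fun x hx => hn x (hG hx)⟩

theorem trace_subset_powerset {X : Type*} (𝒞 : Set (FuzzySet X)) (F : Finset X) :
    trace 𝒞 F ⊆ 𝒫 (F : Set X) := by
  rintro D ⟨C, -, -, rfl⟩
  exact Set.inter_subset_right

theorem encard_powerset_coe {X : Type*} (F : Finset X) :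
    (𝒫 (F : Set X)).encard = 2 ^ F.card := by
  have h : 𝒫 (F : Set X) = (F.powerset.map ⟨_, Finset.coe_injective⟩ : Finset (Set X)) := by
    ext D
    simp only [Finset.coe_map, Function.Embedding.coeFn_mk, Set.mem_image, Finset.mem_coe,
      Finset.mem_powerset, Set.mem_powerset_iff]
    refine ⟨fun hD => ?_, fun ⟨G, hG, hGD⟩ => hGD ▸ Finset.coe_subset.2 hG⟩
    lift D to Finset X using F.finite_toSet.subset hD
    exact ⟨D, Finset.coe_subset.1 hD, rfl⟩
  rw [h, Set.encard_coe_eq_coe_finsetCard, Finset.card_map, Finset.card_powerset]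
  norm_cast

theorem powerset_subset_trace_iff {X : Type*} {𝒞 : Set (FuzzySet X)} {F : Finset X} :
    𝒫 (F : Set X) ⊆ trace 𝒞 F ↔ Shatters 𝒞 F := by
  classical
  constructor
  · intro h D hD
    obtain ⟨C, hC, hdet, hD'⟩ := h (show (D : Set X) ∈ 𝒫 (F : Set X) from Finset.coe_subset.2 hD)
    refine ⟨C, hC, fun x hx => ?_, fun x hx hxD => ?_⟩
    · have : x ∈ (D : Set X) := hx
      rw [hD'] at this
      exact this.1
    · refine (hdet x hx).resolve_left fun hp => hxD ?_
      have : x ∈ C.pos ∩ (F : Set X) := ⟨hp, hx⟩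
      rwa [← hD'] at this
  · intro h D hD
    obtain ⟨C, hC, hp, hn⟩ := h (F.filter (· ∈ D)) (Finset.filter_subset _ _)
    have hp' : ∀ x ∈ D, x ∈ C.pos := fun x hx => hp x (Finset.mem_filter.2 ⟨hD hx, hx⟩)
    have hn' : ∀ x ∈ F, x ∉ D → x ∈ C.neg := fun x hx hxD =>
      hn x hx fun hx' => hxD (Finset.mem_filter.1 hx').2
    refine ⟨C, hC, fun x hx => ?_, ?_⟩
    · by_cases hxD : x ∈ D
      exacts [.inl (hp' x hxD), .inr (hn' x hx hxD)]
    · ext x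
      refine ⟨fun hx => ⟨hp' x hx, hD hx⟩, fun hx => ?_⟩
      by_contra hxD
      exact C.notMem_neg hx.1 (hn' x hx.2 hxD)

theorem shatters_iff_two_pow_le {X : Type*} {𝒞 : Set (FuzzySet X)} {F : Finset X} :
    Shatters 𝒞 F ↔ 2 ^ F.card ≤ (trace 𝒞 F).encard := by
  rw [← powerset_subset_trace_iff, ← encard_powerset_coe]
  refine ⟨fun h => Set.encard_le_encard h, fun h => ?_⟩
  have hfin : (𝒫 (F : Set X)).Finite := F.finite_toSet.finite_subsets
  exact ((hfin.subset (trace_subset_powerset 𝒞 F)).eq_of_subset_of_encard_le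
    (trace_subset_powerset 𝒞 F) h).ge

theorem shatter_lt_two_pow_iff {X : Type*} {𝒞 : Set (FuzzySet X)} {d : ℕ} :
    shatter 𝒞 d < 2 ^ d ↔ ∀ F : Finset X, F.card = d → ¬ Shatters 𝒞 F := by
  have hne : (2 : ℕ∞) ^ d ≠ 0 := by positivity
  have htop : (2 : ℕ∞) ^ d ≠ ⊤ := by
    have : (2 : ℕ∞) ^ d = ((2 ^ d : ℕ) : ℕ∞) := by norm_cast
    rw [this]; exact ENat.natCast_ne_top _
  constructor
  · rintro h F rfl hF
    refine absurd h (not_lt.2 ((shatters_iff_two_pow_le.1 hF).trans ?_))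
    exact le_iSup₂_of_le (f := fun (G : Finset X) (_ : G.card = F.card) => (trace 𝒞 G).encard)
      F rfl le_rfl
  · intro h
    have hle : shatter 𝒞 d ≤ 2 ^ d - 1 := iSup₂_le fun F hF => by
      have := h F hF
      rw [shatters_iff_two_pow_le, hF, not_le] at this
      exact ENat.le_sub_one_of_lt this
    refine hle.trans_lt ?_
    have : (2 : ℕ∞) ^ d = ((2 ^ d : ℕ) : ℕ∞) := by norm_cast
    rw [this]
    have h1 : 0 < 2 ^ d := by positivity
    exact_mod_cast (by omega : 2 ^ d - 1 < 2 ^ d)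

theorem vcIndex_le_iff {X : Type*} {𝒞 : Set (FuzzySet X)} {d : ℕ} :
    vcIndex 𝒞 ≤ d ↔ ∀ F : Finset X, F.card = d → ¬ Shatters 𝒞 F := by
  constructor
  · intro h F hF hsh
    have h' : vcIndex 𝒞 < ((d + 1 : ℕ) : ℕ∞) := h.trans_lt (by exact_mod_cast Nat.lt_succ_self d)
    simp only [vcIndex, iInf_lt_iff] at h'
    obtain ⟨e, he, hed⟩ := h'
    have hed' : e ≤ F.card := by
      rw [hF]; exact Nat.lt_succ_iff.1 (by exact_mod_cast hed)
    obtain ⟨G, hGF, hG⟩ := Finset.exists_subset_card_eq hed'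
    exact shatter_lt_two_pow_iff.1 he G hG (hsh.subset hGF)
  · intro h
    exact iInf₂_le d (shatter_lt_two_pow_iff.2 h)

theorem vcIndex_lt_top_iff {X : Type*} {𝒞 : Set (FuzzySet X)} :
    vcIndex 𝒞 < ⊤ ↔ ∃ d : ℕ, ∀ F : Finset X, F.card = d → ¬ Shatters 𝒞 F := by
  simp only [← vcIndex_le_iff]
  constructor
  · intro h
    lift vcIndex 𝒞 to ℕ using h.ne with d
    exact ⟨d, le_rfl⟩
  · rintro ⟨d, hd⟩
    exact hd.trans_lt (ENat.natCast_lt_top d)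

/-! ### Duality -/

theorem shatters_levelClass_colFamily {X Y : Type*} {φ : X → Y → I} {r s : ℝ} {hrs : r < s}
    {F : Finset X} :
    Shatters (levelClass (colFamily φ) r s hrs) F ↔
      ∀ D ⊆ F, ∃ y, (∀ x ∈ D, s ≤ (φ x y : ℝ)) ∧ ∀ x ∈ F, x ∉ D → (φ x y : ℝ) ≤ r := by
  simp [Shatters, levelClass, colFamily, levelSet]

theorem shatters_levelClass_rowFamily {X Y : Type*} {φ : X → Y → I} {r s : ℝ} {hrs : r < s}
    {F : Finset Y} :
    Shatters (levelClass (rowFamily φ) r s hrs) F ↔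
      ∀ D ⊆ F, ∃ x, (∀ y ∈ D, s ≤ (φ x y : ℝ)) ∧ ∀ y ∈ F, y ∉ D → (φ x y : ℝ) ≤ r := by
  simp [Shatters, levelClass, rowFamily, levelSet]

/-- If the rows shatter a set of `2 ^ d` points of `Y`, label these points by the subsets of
`{0, …, d - 1}`: the rows picking out the labels that contain `i`, for `i < d`, form a set of
`d` points of `X` shattered by the columns. -/
theorem exists_shatters_colFamily_of_rowFamily {X Y : Type*} {φ : X → Y → I} {r s : ℝ}
    {hrs : r < s} {d : ℕ} {F : Finset Y} (hF : F.card = 2 ^ d)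
    (h : Shatters (levelClass (rowFamily φ) r s hrs) F) :
    ∃ G : Finset X, G.card = d ∧ Shatters (levelClass (colFamily φ) r s hrs) G := by
  classical
  rw [shatters_levelClass_rowFamily] at h
  obtain ⟨e⟩ : Nonempty (Finset (Fin d) ≃ F) :=
    Fintype.card_eq.1 (by simp [hF])
  choose x hxpos hxneg using fun i : Fin d =>
    h (F.filter fun y => ∃ S, (e S : Y) = y ∧ i ∈ S) (Finset.filter_subset _ _)
  have hpos : ∀ i S, i ∈ S → s ≤ (φ (x i) (e S) : ℝ) := fun i S hiS =>
    hxpos i _ (Finset.mem_filter.2 ⟨(e S).2, S, rfl, hiS⟩)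
  have hneg : ∀ i S, i ∉ S → (φ (x i) (e S) : ℝ) ≤ r := fun i S hiS => by
    refine hxneg i _ (e S).2 fun hm => hiS ?_
    obtain ⟨-, S', hS', hi⟩ := Finset.mem_filter.1 hm
    rwa [← e.injective (Subtype.ext hS')]
  have hinj : Function.Injective x := fun i j hij => by
    by_contra hne
    have h1 := hpos i {i} (Finset.mem_singleton_self i)
    have h2 := hneg j {i} (by simpa using Ne.symm hne)
    rw [hij] at h1
    exact absurd (h1.trans h2) (not_le.2 hrs)
  refine ⟨Finset.univ.map ⟨x, hinj⟩, by simp, shatters_levelClass_colFamily.2 fun D _ => ?_⟩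
  refine ⟨e (Finset.univ.filter fun i => x i ∈ D), fun z hz => ?_, fun z hz hzD => ?_⟩
  · obtain ⟨i, -, rfl⟩ := Finset.mem_map.1 (‹D ⊆ _› hz)
    exact hpos i _ (Finset.mem_filter.2 ⟨Finset.mem_univ i, hz⟩)
  · obtain ⟨i, -, rfl⟩ := Finset.mem_map.1 hz
    exact hneg i _ fun hi => hzD (Finset.mem_filter.1 hi).2

/-- A family of columns with the Vapnik-Chervonenkis property has rows with this property. -/
theorem IsVCClass.rowFamily {X Y : Type*} {φ : X → Y → I} (h : IsVCClass (colFamily φ)) :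
    IsVCClass (rowFamily φ) := fun r s hrs hr hs => by
  obtain ⟨d, hd⟩ := vcIndex_lt_top_iff.1 (h r s hrs hr hs)
  refine vcIndex_lt_top_iff.2 ⟨2 ^ d, fun F hF hsh => ?_⟩
  obtain ⟨G, hG, hG'⟩ := exists_shatters_colFamily_of_rowFamily hF hsh
  exact hd G hG hG'

/-! ### A Sauer-Shelah lemma for fuzzy sets -/

/-- Two fuzzy sets are separated on `T` if some point of `T` belongs to one of them and is
excluded from the other. -/
def FuzzySet.SeparatedOn {P : Type*} (T : Finset P) (C C' : FuzzySet P) : Prop :=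
  ∃ p ∈ T, (p ∈ C.pos ∧ p ∈ C'.neg) ∨ (p ∈ C'.pos ∧ p ∈ C.neg)

/-- Among sufficiently many pairwise separated fuzzy sets, some point belongs to many of them and
is excluded from many of them: each of the `m (m - 1)` ordered pairs is separated by some
point of `T`, and at most `2 |𝓕⁺| |𝓕⁻|` pairs are separated by a given point. -/
theorem exists_balanced_point {α P : Type*} (c : α → FuzzySet P) (T : Finset P) (𝓕 : Finset α)
    (hsep : (𝓕 : Set α).Pairwise fun f g => (c f).SeparatedOn T (c g)) {m : ℕ} (hm : 0 < m)
    (hcard : (2 * T.card + 2) * m ≤ 𝓕.card) :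
    ∃ p ∈ T, ∃ 𝓕₁ ⊆ 𝓕, ∃ 𝓕₀ ⊆ 𝓕, (∀ f ∈ 𝓕₁, p ∈ (c f).pos) ∧ (∀ f ∈ 𝓕₀, p ∈ (c f).neg) ∧
      m ≤ 𝓕₁.card ∧ m ≤ 𝓕₀.card := by
  classical
  by_contra! hcon
  let A : P → Finset α := fun p => 𝓕.filter fun f => p ∈ (c f).pos
  let B : P → Finset α := fun p => 𝓕.filter fun f => p ∈ (c f).neg
  have hAB : ∀ p ∈ T, (A p).card * (B p).card ≤ 𝓕.card * m := fun p hp => by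
    have hA : (A p).card ≤ 𝓕.card := Finset.card_filter_le _ _
    have hB : (B p).card ≤ 𝓕.card := Finset.card_filter_le _ _
    rcases lt_or_ge (A p).card m with h | h
    · rw [mul_comm]
      exact Nat.mul_le_mul hB h.le
    · exact Nat.mul_le_mul hA (hcon p hp (A p) (Finset.filter_subset _ _) (B p)
        (Finset.filter_subset _ _) (fun f hf => (Finset.mem_filter.1 hf).2)
        (fun f hf => (Finset.mem_filter.1 hf).2) h).le
  have hsub : 𝓕.offDiag ⊆ T.biUnion fun p => A p ×ˢ B p ∪ B p ×ˢ A p := by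
    rintro ⟨f, g⟩ hfg
    obtain ⟨hf, hg, hne⟩ := Finset.mem_offDiag.1 hfg
    obtain ⟨p, hp, h⟩ := hsep hf hg hne
    simp only [Finset.mem_biUnion, Finset.mem_union, Finset.mem_product, A, B, Finset.mem_filter]
    exact ⟨p, hp, h.elim (fun h => .inl ⟨⟨hf, h.1⟩, hg, h.2⟩) fun h => .inr ⟨⟨hf, h.2⟩, hg, h.1⟩⟩
  have hle : 𝓕.offDiag.card ≤ T.card * (2 * (𝓕.card * m)) := by
    refine (Finset.card_le_card hsub).trans (Finset.card_biUnion_le_card_mul _ _ _ fun p hp => ?_)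
    refine (Finset.card_union_le _ _).trans ?_
    rw [Finset.card_product, Finset.card_product, mul_comm (B p).card]
    have := hAB p hp
    omega
  rw [Finset.offDiag_card] at hle
  have hpos : 0 < 𝓕.card := lt_of_lt_of_le (by positivity) hcard
  have h1 : 𝓕.card * 𝓕.card ≤ 𝓕.card * (2 * T.card * m + 1) := by
    have : 𝓕.card * (2 * T.card * m + 1) = T.card * (2 * (𝓕.card * m)) + 𝓕.card := by ring
    omega
  have h2 := Nat.le_of_mul_le_mul_left h1 hpos
  nlinarith

open Classical in
/-- The subsets of `T` shattered by the fuzzy sets `c f`, `f ∈ 𝓕`. -/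
noncomputable def shatteredSets {α P : Type*} (c : α → FuzzySet P) (T : Finset P)
    (𝓕 : Finset α) : Finset (Finset P) :=
  T.powerset.filter fun S => Shatters (c '' 𝓕) S

theorem mem_shatteredSets {α P : Type*} {c : α → FuzzySet P} {T S : Finset P} {𝓕 : Finset α} :
    S ∈ shatteredSets c T 𝓕 ↔ S ⊆ T ∧ Shatters (c '' 𝓕) S := by
  simp [shatteredSets]

/-- If all members of `𝓕₁` contain `p` and all members of `𝓕₀` exclude `p`, then the sets
shattered by `𝓕₁`, those shattered by `𝓕₀`, and the sets `S ∪ {p}` with `S` shattered by both are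
shattered by any `𝓕 ⊇ 𝓕₀ ∪ 𝓕₁`. The last ones are new, since neither of the two families can
shatter a set containing `p`. -/
theorem card_shatteredSets_add_le {α P : Type*} {c : α → FuzzySet P} {T : Finset P}
    {𝓕 𝓕₁ 𝓕₀ : Finset α} {p : P} (hp : p ∈ T) (h₁ : 𝓕₁ ⊆ 𝓕) (h₀ : 𝓕₀ ⊆ 𝓕)
    (hpos : ∀ f ∈ 𝓕₁, p ∈ (c f).pos) (hneg : ∀ f ∈ 𝓕₀, p ∈ (c f).neg) :
    (shatteredSets c T 𝓕₁).card + (shatteredSets c T 𝓕₀).card ≤ (shatteredSets c T 𝓕).card := by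
  classical
  have hp₁ : ∀ S ∈ shatteredSets c T 𝓕₁, p ∉ S := fun S hS hpS => by
    obtain ⟨_, ⟨f, hf, rfl⟩, -, hn⟩ := (mem_shatteredSets.1 hS).2 ∅ (Finset.empty_subset _)
    exact (c f).notMem_neg (hpos f hf) (hn p hpS (Finset.notMem_empty p))
  have hp₀ : ∀ S ∈ shatteredSets c T 𝓕₀, p ∉ S := fun S hS hpS => by
    obtain ⟨_, ⟨f, hf, rfl⟩, hq, -⟩ := (mem_shatteredSets.1 hS).2 S subset_rfl
    exact (c f).notMem_neg (hq p hpS) (hneg f hf)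
  set U := shatteredSets c T 𝓕₁ ∪ shatteredSets c T 𝓕₀ with hU
  set V := (shatteredSets c T 𝓕₁ ∩ shatteredSets c T 𝓕₀) with hV
  have hVimg : (V.image (insert p)).card = V.card := by
    refine Finset.card_image_of_injOn fun S hS S' hS' h => ?_
    have hS1 := hp₁ S (Finset.mem_inter.1 hS).1
    have hS1' := hp₁ S' (Finset.mem_inter.1 hS').1
    rw [← Finset.erase_insert hS1, ← Finset.erase_insert hS1']
    exact congrArg (fun R => R.erase p) h
  have hdisj : Disjoint U (V.image (insert p)) := by
    rw [Finset.disjoint_right]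
    intro S hS hSU
    obtain ⟨R, -, rfl⟩ := Finset.mem_image.1 hS
    rcases Finset.mem_union.1 hSU with h | h
    exacts [hp₁ _ h (Finset.mem_insert_self _ _), hp₀ _ h (Finset.mem_insert_self _ _)]
  have hsub : U ∪ V.image (insert p) ⊆ shatteredSets c T 𝓕 := by
    refine Finset.union_subset (Finset.union_subset ?_ ?_) ?_
    · exact fun S hS => mem_shatteredSets.2 ((mem_shatteredSets.1 hS).imp_right
        (Shatters.mono (Set.image_mono h₁)))
    · exact fun S hS => mem_shatteredSets.2 ((mem_shatteredSets.1 hS).imp_right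
        (Shatters.mono (Set.image_mono h₀)))
    · intro S' hS'
      obtain ⟨S, hS, rfl⟩ := Finset.mem_image.1 hS'
      obtain ⟨hS1, hS0⟩ := Finset.mem_inter.1 hS
      have hpS := hp₁ S hS1
      obtain ⟨hST, hsh1⟩ := mem_shatteredSets.1 hS1
      obtain ⟨-, hsh0⟩ := mem_shatteredSets.1 hS0
      refine mem_shatteredSets.2 ⟨Finset.insert_subset hp hST, fun D hD => ?_⟩
      have hDS : D.erase p ⊆ S := Finset.subset_insert_iff.1 hD
      by_cases hpD : p ∈ D
      · obtain ⟨_, ⟨f, hf, rfl⟩, hq, hn⟩ := hsh1 _ hDS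
        refine ⟨_, ⟨f, h₁ hf, rfl⟩, fun x hx => ?_, fun x hx hxD => ?_⟩
        · by_cases hxp : x = p
          · exact hxp ▸ hpos f hf
          · exact hq x (Finset.mem_erase.2 ⟨hxp, hx⟩)
        · have hxp : x ≠ p := fun h => hxD (h ▸ hpD)
          exact hn x (Finset.mem_of_mem_insert_of_ne hx hxp) fun h => hxD (Finset.mem_of_mem_erase h)
      · obtain ⟨_, ⟨f, hf, rfl⟩, hq, hn⟩ := hsh0 _ hDS
        refine ⟨_, ⟨f, h₀ hf, rfl⟩, fun x hx => ?_, fun x hx hxD => ?_⟩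
        · exact hq x (Finset.mem_erase.2 ⟨fun h => hpD (h ▸ hx), hx⟩)
        · by_cases hxp : x = p
          · exact hxp ▸ hneg f hf
          · exact hn x (Finset.mem_of_mem_insert_of_ne hx hxp) fun h =>
              hxD (Finset.mem_of_mem_erase h)
  calc _ = U.card + V.card := (Finset.card_union_add_card_inter _ _).symm
    _ = (U ∪ V.image (insert p)).card := by rw [Finset.card_union_of_disjoint hdisj, hVimg]
    _ ≤ _ := Finset.card_le_card hsub

/-- Many pairwise separated fuzzy sets shatter many sets. -/
theorem two_pow_le_card_shatteredSets {α P : Type*} (c : α → FuzzySet P) (T : Finset P) (r : ℕ)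
    (𝓕 : Finset α) (hsep : (𝓕 : Set α).Pairwise fun f g => (c f).SeparatedOn T (c g))
    (hcard : (2 * T.card + 2) ^ r ≤ 𝓕.card) : 2 ^ r ≤ (shatteredSets c T 𝓕).card := by
  induction r generalizing 𝓕 with
  | zero =>
    obtain ⟨f, hf⟩ := Finset.card_pos.1 (lt_of_lt_of_le Nat.one_pos (by simpa using hcard))
    refine Finset.card_pos.2 ⟨∅, mem_shatteredSets.2 ⟨Finset.empty_subset T, fun D hD => ?_⟩⟩
    exact ⟨c f, ⟨f, hf, rfl⟩, fun x hx => absurd (hD hx) (Finset.notMem_empty x),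
      fun x hx => absurd hx (Finset.notMem_empty x)⟩
  | succ r ih =>
    obtain ⟨p, hp, 𝓕₁, h₁, 𝓕₀, h₀, hpos, hneg, hc₁, hc₀⟩ := exists_balanced_point c T 𝓕 hsep
      (m := (2 * T.card + 2) ^ r) (by positivity) (by rwa [← pow_succ'])
    have i₁ := ih 𝓕₁ (hsep.mono (Finset.coe_subset.2 h₁)) hc₁
    have i₀ := ih 𝓕₀ (hsep.mono (Finset.coe_subset.2 h₀)) hc₀
    have := card_shatteredSets_add_le hp h₁ h₀ hpos hneg
    rw [pow_succ]
    omega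

theorem sum_range_pow_lt (N D : ℕ) : ∑ i ∈ Finset.range D, N ^ i < (N + 2) ^ D := by
  induction D with
  | zero => simp
  | succ D ih =>
    have h : N ^ D ≤ (N + 2) ^ D := Nat.pow_le_pow_left (by omega) D
    rw [Finset.sum_range_succ, pow_succ, mul_add]
    have := Nat.zero_le ((N + 2) ^ D * N)
    omega

theorem card_filter_card_lt_lt {P : Type*} (T : Finset P) (D : ℕ) :
    (T.powerset.filter fun S => S.card < D).card < (T.card + 2) ^ D := by
  classical
  refine lt_of_le_of_lt ?_ (sum_range_pow_lt T.card D)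
  have hsub : (T.powerset.filter fun S => S.card < D) ⊆
      (Finset.range D).biUnion fun i => T.powersetCard i := fun S hS => by
    obtain ⟨hS, hSD⟩ := Finset.mem_filter.1 hS
    exact Finset.mem_biUnion.2 ⟨S.card, Finset.mem_range.2 hSD,
      Finset.mem_powersetCard.2 ⟨Finset.mem_powerset.1 hS, rfl⟩⟩
  refine (Finset.card_le_card hsub).trans (Finset.card_biUnion_le.trans ?_)
  refine Finset.sum_le_sum fun i _ => ?_
  rw [Finset.card_powersetCard]
  exact Nat.choose_le_pow _ _

/-- A family of pairwise separated fuzzy sets on `N` points that shatters no set of size `D` has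
quasi-polynomial size `N ^ O(D log N)`. -/
theorem card_lt_of_not_shatters {α P : Type*} (c : α → FuzzySet P) (T : Finset P) (D : ℕ)
    (𝓕 : Finset α) (hsep : (𝓕 : Set α).Pairwise fun f g => (c f).SeparatedOn T (c g))
    (hsh : ∀ S ⊆ T, S.card = D → ¬ Shatters (c '' 𝓕) S) :
    𝓕.card < (2 * T.card + 2) ^ ((Nat.log 2 (T.card + 2) + 1) * D) := by
  by_contra! hcard
  have h := two_pow_le_card_shatteredSets c T _ 𝓕 hsep hcard
  have hsub : shatteredSets c T 𝓕 ⊆ T.powerset.filter fun S => S.card < D := fun S hS => by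
    obtain ⟨hST, hS⟩ := mem_shatteredSets.1 hS
    refine Finset.mem_filter.2 ⟨Finset.mem_powerset.2 hST, ?_⟩
    by_contra! hD
    obtain ⟨R, hRS, hR⟩ := Finset.exists_subset_card_eq hD
    exact hsh R (hRS.trans hST) hR (hS.subset hRS)
  have h1 := (h.trans (Finset.card_le_card hsub)).trans_lt (card_filter_card_lt_lt T D)
  rw [pow_mul] at h1
  exact absurd h1 (not_lt.2 (Nat.pow_le_pow_left (Nat.lt_pow_succ_log_self one_lt_two _).le D))

/-! ### Uniform approximation by few columns -/

theorem exists_maximal_pairwise {α : Type*} {R : α → α → Prop} (hsymm : ∀ a b, R a b → R b a)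
    (hirr : ∀ a, ¬ R a a) {M : ℕ}
    (hM : ∀ 𝓕 : Finset α, (𝓕 : Set α).Pairwise R → 𝓕.card < M) :
    ∃ 𝓕 : Finset α, (𝓕 : Set α).Pairwise R ∧ ∀ a, ∃ b ∈ 𝓕, ¬ R a b := by
  classical
  let s : Set ℕ := {k | ∃ 𝓕 : Finset α, (𝓕 : Set α).Pairwise R ∧ 𝓕.card = k}
  have hb : BddAbove s := ⟨M, by rintro _ ⟨𝓕, h, rfl⟩; exact (hM 𝓕 h).le⟩
  obtain ⟨𝓕, h𝓕, hcard⟩ := Nat.sSup_mem (s := s) ⟨0, ∅, by simp, rfl⟩ hb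
  refine ⟨𝓕, h𝓕, fun a => ?_⟩
  by_contra! ha
  have ha𝓕 : a ∉ 𝓕 := fun h => hirr a (ha a h)
  have hins : ((insert a 𝓕 : Finset α) : Set α).Pairwise R := by
    rw [Finset.coe_insert, Set.pairwise_insert]
    exact ⟨h𝓕, fun b hb _ => ⟨ha b hb, hsymm a b (ha b hb)⟩⟩
  have := le_csSup hb ⟨_, hins, rfl⟩
  rw [Finset.card_insert_of_notMem ha𝓕, hcard] at this
  omega

theorem FuzzySet.SeparatedOn.symm {P : Type*} {T : Finset P} {C C' : FuzzySet P}
    (h : C.SeparatedOn T C') : C'.SeparatedOn T C :=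
  let ⟨p, hp, hpC⟩ := h
  ⟨p, hp, hpC.symm⟩

theorem FuzzySet.not_separatedOn_self {P : Type*} (T : Finset P) (C : FuzzySet P) :
    ¬ C.SeparatedOn T C := fun ⟨_, _, h⟩ => h.elim (fun h => C.notMem_neg h.1 h.2)
  fun h => C.notMem_neg h.1 h.2

theorem lt_add_one_div {K : ℕ} (hK : 0 < K) (a : ℝ) : a < a + 1 / K :=
  lt_add_of_pos_right a (by positivity)

/-- A function `q : Fin n → [0,1]` as a fuzzy subset of a grid: the point `(i, k)` is in if
`(k + 1) / K ≤ q i`, and out if `q i ≤ k / K`. Shattering by these fuzzy sets allows the level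
`k` to vary with `i`. -/
def gridFuzzySet {n K : ℕ} (hK : 0 < K) (q : Fin n → I) : FuzzySet (Fin n × ℕ) where
  pos := {p | (p.2 : ℝ) / K + 1 / K ≤ q p.1}
  neg := {p | (q p.1 : ℝ) ≤ p.2 / K}
  disj := Set.disjoint_left.mpr fun _ hp hn =>
    absurd (le_trans hp hn) (not_le.2 (lt_add_one_div hK _))

theorem abs_sub_le_of_not_separatedOn {n K : ℕ} (hK : 0 < K) {q q' : Fin n → I}
    (h : ¬ (gridFuzzySet hK q).SeparatedOn (Finset.univ ×ˢ Finset.range K) (gridFuzzySet hK q'))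
    (i : Fin n) : |(q i : ℝ) - q' i| ≤ 2 / K := by
  have hK' : (0 : ℝ) < K := by exact_mod_cast hK
  -- If `2 / K < b - a`, the interval `[a, b]` contains two consecutive multiples of `1 / K`.
  have key : ∀ a b : I, 2 / (K : ℝ) < b - a →
      ∃ k < K, (a : ℝ) ≤ k / K ∧ (k : ℝ) / K + 1 / K ≤ b := fun a b hab => by
    have hceil := Nat.ceil_lt_add_one (mul_nonneg hK'.le a.2.1)
    have hle := Nat.le_ceil ((K : ℝ) * a)
    set k := ⌈(K : ℝ) * a⌉₊
    have hab' : 2 < K * ((b : ℝ) - a) := by rwa [div_lt_iff₀' hK'] at hab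
    have hkb : (k : ℝ) + 1 ≤ K * b := by nlinarith
    have hb1 : (K : ℝ) * b ≤ K := mul_le_of_le_one_right hK'.le b.2.2
    refine ⟨k, ?_, ?_, ?_⟩
    · have : (k : ℝ) < K := by linarith
      exact_mod_cast this
    · rwa [le_div_iff₀' hK']
    · rwa [← add_div, div_le_iff₀' hK']
  by_contra! hlt
  refine h ?_
  rcases lt_abs.1 hlt with hlt | hlt
  · obtain ⟨k, hk, h0, h1⟩ := key _ _ hlt
    exact ⟨(i, k), by simpa using hk, .inl ⟨h1, h0⟩⟩
  · obtain ⟨k, hk, h0, h1⟩ := key (q i) (q' i) (by linarith)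
    exact ⟨(i, k), by simpa using hk, .inr ⟨h1, h0⟩⟩

/-- A set of `d * K` grid points shattered by the columns has, by the pigeonhole principle, `d`
points at one level `k`, and these project to `d` distinct points of `X`. -/
theorem exists_shatters_levelClass_of_grid {X Y : Type*} {φ : X → Y → I} {n K d : ℕ} (hK : 0 < K)
    (x : Fin n → X) {𝒴 : Set Y} {S : Finset (Fin n × ℕ)}
    (hS : S ⊆ Finset.univ ×ˢ Finset.range K) (hcard : S.card = d * K)
    (hsh : Shatters ((fun y => gridFuzzySet hK fun i => φ (x i) y) '' 𝒴) S) :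
    ∃ k < K, ∃ F : Finset X, F.card = d ∧
      Shatters (levelClass (colFamily φ) (k / K) (k / K + 1 / K) (lt_add_one_div hK _)) F := by
  classical
  obtain ⟨k, hk, hkd⟩ := Finset.exists_le_card_fiber_of_mul_le_card_of_maps_to
    (s := S) (t := Finset.range K) (f := Prod.snd) (n := d)
    (fun p hp => (Finset.mem_product.1 (hS hp)).2) ⟨0, Finset.mem_range.2 hK⟩
    (by rw [Finset.card_range, hcard, mul_comm])
  obtain ⟨R, hRS, hR⟩ := Finset.exists_subset_card_eq hkd
  have hRk : ∀ p ∈ R, p.2 = k := fun p hp => (Finset.mem_filter.1 (hRS hp)).2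
  have hRsh := hsh.subset (hRS.trans (Finset.filter_subset _ _))
  have hsplit : ∀ D ⊆ R, ∃ y, (∀ p ∈ D, (k : ℝ) / K + 1 / K ≤ φ (x p.1) y) ∧
      ∀ p ∈ R, p ∉ D → (φ (x p.1) y : ℝ) ≤ k / K := fun D hD => by
    obtain ⟨_, ⟨y, -, rfl⟩, hp, hn⟩ := hRsh D hD
    refine ⟨y, fun p hpD => ?_, fun p hpR hpD => ?_⟩
    · have := hp p hpD
      simpa [gridFuzzySet, hRk p (hD hpD)] using this
    · have := hn p hpR hpD
      simpa [gridFuzzySet, hRk p hpR] using this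
  have hinj : Set.InjOn (fun p : Fin n × ℕ => x p.1) R := fun p hp q hq hpq => by
    by_contra hne
    obtain ⟨y, h1, h0⟩ := hsplit {p} (Finset.singleton_subset_iff.2 hp)
    have h1' := h1 p (Finset.mem_singleton_self p)
    have h0' := h0 q hq (by simpa using Ne.symm hne)
    rw [show x p.1 = x q.1 from hpq] at h1'
    exact absurd (h1'.trans h0') (not_le.2 (lt_add_one_div hK _))
  refine ⟨k, Finset.mem_range.1 hk, R.image fun p => x p.1,
    by rw [Finset.card_image_of_injOn hinj, hR], shatters_levelClass_colFamily.2 fun D hD => ?_⟩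
  obtain ⟨y, h1, h0⟩ := hsplit (R.filter fun p => x p.1 ∈ D) (Finset.filter_subset _ _)
  refine ⟨y, fun z hz => ?_, fun z hz hzD => ?_⟩
  · obtain ⟨p, hp, rfl⟩ := Finset.mem_image.1 (hD hz)
    exact h1 p (Finset.mem_filter.2 ⟨hp, hz⟩)
  · obtain ⟨p, hp, rfl⟩ := Finset.mem_image.1 hz
    exact h0 p hp fun h => hzD (Finset.mem_filter.1 h).2

/-- The bound for the size of a net in `exists_net_colFamily`. -/
def netBound (d K n : ℕ) : ℕ :=
  (2 * (n * K) + 2) ^ ((Nat.log 2 (n * K + 2) + 1) * (d * K))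

/-- If the columns of `φ` shatter no set of size `d` between consecutive multiples of `1 / K`,
then on any `n` points they are all within `2 / K` of a few of them. -/
theorem exists_net_colFamily {X Y : Type*} {φ : X → Y → I} {K d : ℕ} (hK : 0 < K)
    (h : ∀ k < K, vcIndex (levelClass (colFamily φ) (k / K) (k / K + 1 / K)
      (lt_add_one_div hK _)) ≤ d) {n : ℕ} (x : Fin n → X) :
    ∃ 𝓕 : Finset Y, 𝓕.card < netBound d K n ∧
      ∀ y, ∃ y' ∈ 𝓕, ∀ i, |(φ (x i) y : ℝ) - φ (x i) y'| ≤ 2 / K := by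
  let c : Y → FuzzySet (Fin n × ℕ) := fun y => gridFuzzySet hK fun i => φ (x i) y
  let T : Finset (Fin n × ℕ) := Finset.univ ×ˢ Finset.range K
  have hbound : ∀ 𝓕 : Finset Y,
      (𝓕 : Set Y).Pairwise (fun f g => (c f).SeparatedOn T (c g)) →
      𝓕.card < netBound d K n := fun 𝓕 hsep => by
    have := card_lt_of_not_shatters c T (d * K) 𝓕 hsep fun S hST hS hsh => by
      obtain ⟨k, hk, F, hF, hF'⟩ := exists_shatters_levelClass_of_grid hK x hST hS hsh
      exact vcIndex_le_iff.1 (h k hk) F hF hF'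
    simpa [T, netBound] using this
  obtain ⟨𝓕, hsep, hmax⟩ := exists_maximal_pairwise
    (R := fun f g => (c f).SeparatedOn T (c g))
    (fun _ _ h => h.symm)
    (fun f => FuzzySet.not_separatedOn_self T (c f)) hbound
  refine ⟨𝓕, hbound 𝓕 hsep, fun y => ?_⟩
  obtain ⟨y', hy', hns⟩ := hmax y
  exact ⟨y', hy', abs_sub_le_of_not_separatedOn hK hns⟩

/-- The logarithm of `netBound d K n` is `O((log n) ^ 2)`, hence `o(n)`. -/
theorem exists_log_netBound_le (d : ℕ) {K : ℕ} (hK : 0 < K) {η : ℝ} (hη : 0 < η) :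
    ∃ n : ℕ, 0 < n ∧ Real.log (netBound d K n) ≤ η * n := by
  have hlo := (Real.isLittleO_pow_log_id_atTop (n := 2)).def
    (show 0 < η / ((2 * K + 4) * (2 * (d * K) + 1)) by positivity)
  have ht : Filter.Tendsto (fun n : ℕ => (2 * (n * K) + 4 : ℝ)) Filter.atTop Filter.atTop := by
    refine Filter.tendsto_atTop_mono (fun n => ?_) tendsto_natCast_atTop_atTop
    have h1 : (1 : ℝ) ≤ K := by exact_mod_cast hK
    have h0 : (0 : ℝ) ≤ n := n.cast_nonneg
    nlinarith
  obtain ⟨n, hn, hn0⟩ := ((ht.eventually hlo).and (Filter.eventually_gt_atTop 0)).exists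
  refine ⟨n, hn0, ?_⟩
  set t : ℝ := 2 * (n * K) + 4 with ht_def
  have hnK : (0 : ℝ) ≤ n * K := by positivity
  have ht4 : 4 ≤ t := by linarith
  have hlogt : 0 ≤ Real.log t := Real.log_nonneg (by linarith)
  simp only [Real.norm_eq_abs, id, abs_of_nonneg (sq_nonneg (Real.log t)),
    abs_of_nonneg (show 0 ≤ t by linarith)] at hn
  have hlog2 : 1 / 2 ≤ Real.log 2 := by have := Real.log_two_gt_d9; linarith
  have h1 : (Nat.log 2 (n * K + 2) : ℝ) + 1 ≤ 2 * Real.log t := by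
    have h := Real.natLog_le_logb (n * K + 2) 2
    have hlt : Real.log t = Real.log 2 + Real.log (n * K + 2) := by
      rw [← Real.log_mul (by norm_num) (by positivity), ht_def]
      ring_nf
    push_cast at h
    rw [Real.logb, le_div_iff₀ (by linarith)] at h
    have h0 : (0 : ℝ) ≤ Nat.log 2 (n * K + 2) := Nat.cast_nonneg _
    nlinarith
  have h2 : Real.log (2 * (n * K) + 2) ≤ Real.log t :=
    Real.log_le_log (by positivity) (by linarith)
  have h2' : 0 ≤ Real.log (2 * (n * K) + 2 : ℝ) := Real.log_nonneg (by linarith)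
  have htn : t ≤ (2 * K + 4) * n := by
    have : (1 : ℝ) ≤ n := by exact_mod_cast hn0
    rw [ht_def]
    nlinarith
  have hdK : (0 : ℝ) ≤ d * K := by positivity
  rw [netBound]
  push_cast
  rw [Real.log_pow]
  push_cast
  calc ((Nat.log 2 (n * K + 2) : ℝ) + 1) * (d * K) * Real.log (2 * (n * K) + 2)
      ≤ 2 * Real.log t * (d * K) * Real.log t := by gcongr
    _ = (2 * (d * K)) * Real.log t ^ 2 := by ring
    _ ≤ (2 * (d * K) + 1) * Real.log t ^ 2 := by gcongr; linarith
    _ ≤ (2 * (d * K) + 1) * (η / ((2 * K + 4) * (2 * (d * K) + 1)) * ((2 * K + 4) * n)) := by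
        gcongr
        exact hn.trans (by gcongr)
    _ = η * n := by field_simp

/-! ### Support functions of the sets `φ^Y(x̄)` -/

/-- The standard Gaussian measure on `ℝⁿ`. -/
noncomputable abbrev stdGaussianPi (n : ℕ) : Measure (Fin n → ℝ) :=
  Measure.pi fun _ : Fin n => gaussianReal 0 1

/-- The first absolute moment of the standard Gaussian distribution on the line. -/
noncomputable def gaussianAbsMoment : ℝ := ∫ t, |t| ∂(gaussianReal 0 1)

theorem abs_dotProduct_le {n : ℕ} {a : Fin n → ℝ} {ε : ℝ} (ha : ∀ i, |a i| ≤ ε) (u : Fin n → ℝ) :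
    |a ⬝ᵥ u| ≤ ε * ∑ i, |u i| := by
  rw [dotProduct, Finset.mul_sum]
  refine (Finset.abs_sum_le_sum_abs _ _).trans (Finset.sum_le_sum fun i _ => ?_)
  rw [abs_mul]
  exact mul_le_mul_of_nonneg_right (ha i) (abs_nonneg _)

theorem abs_dotProduct_unitInterval_le {n : ℕ} (q : Fin n → I) (u : Fin n → ℝ) :
    |(fun i => (q i : ℝ)) ⬝ᵥ u| ≤ ∑ i, |u i| := by
  simpa using abs_dotProduct_le (a := fun i => (q i : ℝ)) (ε := 1)
    (fun i => abs_le.2 ⟨by linarith [(q i).2.1], (q i).2.2⟩) u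

section

variable {X Y : Type*} (φ : X → Y → I) {n : ℕ} (x : Fin n → X) (u : Fin n → ℝ)

theorem supportFun_evalSet_colFamily :
    supportFun (evalSet (colFamily φ) x) u = ⨆ y, (fun i => (φ (x i) y : ℝ)) ⬝ᵥ u := by
  rw [supportFun, evalSet, colFamily, ← Set.range_comp, ← Set.range_comp]
  rfl

theorem bddAbove_range_dotProduct :
    BddAbove (Set.range fun y => (fun i => (φ (x i) y : ℝ)) ⬝ᵥ u) := by
  refine ⟨∑ i, |u i|, ?_⟩
  rintro _ ⟨y, rfl⟩
  exact (le_abs_self _).trans (abs_dotProduct_unitInterval_le (fun i => φ (x i) y) u)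

theorem dotProduct_le_supportFun (y : Y) :
    (fun i => (φ (x i) y : ℝ)) ⬝ᵥ u ≤ supportFun (evalSet (colFamily φ) x) u := by
  rw [supportFun_evalSet_colFamily]
  exact le_ciSup (bddAbove_range_dotProduct φ x u) y

theorem supportFun_of_isEmpty [IsEmpty Y] : supportFun (evalSet (colFamily φ) x) u = 0 := by
  rw [supportFun_evalSet_colFamily, Real.iSup_of_isEmpty]

theorem abs_supportFun_le : |supportFun (evalSet (colFamily φ) x) u| ≤ ∑ i, |u i| := by
  cases isEmpty_or_nonempty Y
  · rw [supportFun_of_isEmpty, abs_zero]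
    exact Finset.sum_nonneg fun i _ => abs_nonneg _
  · refine abs_le.2 ⟨?_, ?_⟩
    · obtain ⟨y⟩ := ‹Nonempty Y›
      exact (neg_le_of_abs_le (abs_dotProduct_unitInterval_le (fun i => φ (x i) y) u)).trans
        (dotProduct_le_supportFun φ x u y)
    · rw [supportFun_evalSet_colFamily]
      exact ciSup_le fun y =>
        (le_abs_self _).trans (abs_dotProduct_unitInterval_le (fun i => φ (x i) y) u)

theorem width_nonneg : 0 ≤ width (evalSet (colFamily φ) x) u := by
  cases isEmpty_or_nonempty Y
  · simp [width, supportFun_of_isEmpty]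
  · obtain ⟨y⟩ := ‹Nonempty Y›
    have h1 := dotProduct_le_supportFun φ x u y
    have h2 := dotProduct_le_supportFun φ x (-u) y
    rw [dotProduct_neg] at h2
    rw [width]
    linarith

theorem width_le : width (evalSet (colFamily φ) x) u ≤ 2 * ∑ i, |u i| := by
  have h1 := (le_abs_self _).trans (abs_supportFun_le φ x u)
  have h2 := (le_abs_self _).trans (abs_supportFun_le φ x (-u))
  simp only [Pi.neg_apply, abs_neg] at h2
  rw [width]
  linarith

theorem gaussianMeanWidth_nonneg : 0 ≤ gaussianMeanWidth (evalSet (colFamily φ) x) :=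
  integral_nonneg fun u => width_nonneg φ x u

theorem widthGrowth_nonneg (n : ℕ) : 0 ≤ widthGrowth (colFamily φ) n :=
  Real.iSup_nonneg fun x => gaussianMeanWidth_nonneg φ x

end

section

variable {Ω X Y : Type*} [MeasurableSpace Ω] [Countable Y] {φ : Ω → X → Y → I} {n : ℕ}

theorem measurable_supportFun (hφ : ∀ x y, Measurable fun ω => φ ω x y) (x : Fin n → X) :
    Measurable fun p : Ω × (Fin n → ℝ) => supportFun (evalSet (colFamily (φ p.1)) x) p.2 := by
  simp only [supportFun_evalSet_colFamily]
  refine Measurable.iSup fun y => Finset.measurable_sum _ fun i _ => ?_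
  exact ((hφ (x i) y).subtype_val.comp measurable_fst).mul
    ((measurable_pi_apply i).comp measurable_snd)

theorem measurable_width (hφ : ∀ x y, Measurable fun ω => φ ω x y) (x : Fin n → X) :
    Measurable fun p : Ω × (Fin n → ℝ) => width (evalSet (colFamily (φ p.1)) x) p.2 :=
  (measurable_supportFun hφ x).add
    ((measurable_supportFun hφ x).comp (measurable_fst.prodMk measurable_snd.neg))

theorem measurable_supportFun_right (ψ : X → Y → I) (x : Fin n → X) :
    Measurable fun u => supportFun (evalSet (colFamily ψ) x) u :=
  (measurable_supportFun (φ := fun _ : Unit => ψ) (fun _ _ => measurable_const) x).comp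
    (measurable_prodMk_left (x := ()))

theorem measurable_gaussianMeanWidth (hφ : ∀ x y, Measurable fun ω => φ ω x y) (x : Fin n → X) :
    Measurable fun ω => gaussianMeanWidth (evalSet (colFamily (φ ω)) x) :=
  ((measurable_width hφ x).stronglyMeasurable.integral_prod_right
    (ν := stdGaussianPi n)).measurable

theorem measurable_widthGrowth [Countable X] (hφ : ∀ x y, Measurable fun ω => φ ω x y) (n : ℕ) :
    Measurable fun ω => widthGrowth (colFamily (φ ω)) n :=
  Measurable.iSup fun x => measurable_gaussianMeanWidth hφ x

end

/-! ### Gaussian integrals -/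

theorem integrable_abs_gaussianReal : Integrable (fun t : ℝ => |t|) (gaussianReal 0 1) :=
  ((memLp_id_gaussianReal 1).integrable (by simp)).abs

theorem gaussianAbsMoment_pos : 0 < gaussianAbsMoment := by
  rw [gaussianAbsMoment, integral_pos_iff_support_of_nonneg (fun t => abs_nonneg t)
    integrable_abs_gaussianReal]
  have hs : Function.support (fun t : ℝ => |t|) = {0}ᶜ := by ext t; simp
  have := nullSingletonClass_gaussianReal (μ := 0) (v := 1) one_ne_zero
  rw [hs, measure_compl (measurableSet_singleton 0) (measure_ne_top _ _)]
  simp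

theorem integrable_sum_abs (n : ℕ) :
    Integrable (fun u : Fin n → ℝ => ∑ i, |u i|) (stdGaussianPi n) :=
  integrable_finsetSum _ fun _ _ => integrable_comp_eval integrable_abs_gaussianReal

theorem integral_sum_abs (n : ℕ) :
    ∫ u : Fin n → ℝ, ∑ i, |u i| ∂(stdGaussianPi n) = n * gaussianAbsMoment := by
  rw [integral_finsetSum _ fun _ _ => integrable_comp_eval integrable_abs_gaussianReal]
  have h : ∀ i : Fin n, ∫ u : Fin n → ℝ, |u i| ∂(stdGaussianPi n) = gaussianAbsMoment := fun i =>
    integral_comp_eval (μ := fun _ : Fin n => gaussianReal 0 1) (f := fun t : ℝ => |t|)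
      integrable_abs_gaussianReal.aestronglyMeasurable
  simp [h]

theorem exp_mul_dotProduct {n : ℕ} (c : ℝ) (a u : Fin n → ℝ) :
    Real.exp (c * (a ⬝ᵥ u)) = ∏ i, Real.exp (c * a i * u i) := by
  rw [← Real.exp_sum, dotProduct, Finset.mul_sum]
  simp only [mul_assoc]

theorem integrable_exp_mul_dotProduct {n : ℕ} (c : ℝ) (a : Fin n → ℝ) :
    Integrable (fun u => Real.exp (c * (a ⬝ᵥ u))) (stdGaussianPi n) := by
  simp only [exp_mul_dotProduct]
  exact Integrable.fintype_prod (f := fun i t => Real.exp (c * a i * t))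
    fun i => integrable_exp_mul_gaussianReal _

theorem integral_exp_mul_dotProduct_le {n : ℕ} (c : ℝ) (q : Fin n → I) :
    ∫ u, Real.exp (c * ((fun i => (q i : ℝ)) ⬝ᵥ u)) ∂(stdGaussianPi n) ≤
      Real.exp (n * (c ^ 2 / 2)) := by
  simp only [exp_mul_dotProduct]
  rw [integral_fintype_prod_eq_prod (fun i t => Real.exp (c * (q i : ℝ) * t))]
  have h : ∀ i, ∫ t, Real.exp (c * (q i : ℝ) * t) ∂(gaussianReal 0 1) =
      Real.exp ((c * q i) ^ 2 / 2) := fun i => by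
    have := congrFun (mgf_id_gaussianReal (μ := 0) (v := 1)) (c * q i)
    simpa [mgf] using this
  simp only [h]
  calc ∏ i, Real.exp ((c * q i) ^ 2 / 2) ≤ ∏ _i : Fin n, Real.exp (c ^ 2 / 2) := by
        refine Finset.prod_le_prod (fun i _ => (Real.exp_pos _).le) fun i _ => ?_
        rw [mul_pow]
        have h1 : (q i : ℝ) ^ 2 ≤ 1 := pow_le_one₀ (q i).2.1 (q i).2.2
        have h2 : c ^ 2 * (q i : ℝ) ^ 2 ≤ c ^ 2 := mul_le_of_le_one_right (sq_nonneg c) h1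
        gcongr
    _ = _ := by rw [Finset.prod_const, Finset.card_univ, Fintype.card_fin, ← Real.exp_nat_mul]

section

variable {X Y : Type*} [Countable Y] (φ : X → Y → I) {n : ℕ} (x : Fin n → X)

theorem integrable_supportFun :
    Integrable (fun u => supportFun (evalSet (colFamily φ) x) u) (stdGaussianPi n) :=
  (integrable_sum_abs n).mono' (measurable_supportFun_right φ x).aestronglyMeasurable
    (ae_of_all _ fun u => abs_supportFun_le φ x u)

theorem integrable_supportFun_neg :
    Integrable (fun u => supportFun (evalSet (colFamily φ) x) (-u)) (stdGaussianPi n) :=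
  (integrable_sum_abs n).mono'
    ((measurable_supportFun_right φ x).comp measurable_neg).aestronglyMeasurable
    (ae_of_all _ fun u => by simpa using abs_supportFun_le φ x (-u))

theorem integrable_width :
    Integrable (fun u => width (evalSet (colFamily φ) x) u) (stdGaussianPi n) :=
  (integrable_supportFun φ x).add (integrable_supportFun_neg φ x)

theorem gaussianMeanWidth_le :
    gaussianMeanWidth (evalSet (colFamily φ) x) ≤ 2 * (n * gaussianAbsMoment) := by
  rw [← integral_sum_abs, ← integral_const_mul]
  exact integral_mono (integrable_width φ x) ((integrable_sum_abs n).const_mul 2)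
    fun u => width_le φ x u

theorem gaussianMeanWidth_le_widthGrowth :
    gaussianMeanWidth (evalSet (colFamily φ) x) ≤ widthGrowth (colFamily φ) n :=
  le_ciSup (f := fun x : Fin n → X => gaussianMeanWidth (evalSet (colFamily φ) x))
    ⟨2 * (n * gaussianAbsMoment), by rintro _ ⟨x, rfl⟩; exact gaussianMeanWidth_le φ x⟩ x

theorem widthGrowth_le (n : ℕ) :
    widthGrowth (colFamily φ) n ≤ 2 * (n * gaussianAbsMoment) :=
  Real.iSup_le (fun x => gaussianMeanWidth_le φ x)
    (by have := gaussianAbsMoment_pos; positivity)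

end

/-! ### Convexity of the mean width -/

section

variable {Ω X Y : Type*} [MeasurableSpace Ω] [Countable Y] (μ : Measure Ω) [IsProbabilityMeasure μ]
  {φ : Ω → X → Y → I} {n : ℕ}

theorem integrable_widthGrowth [Countable X] (hφ : ∀ x y, Measurable fun ω => φ ω x y) (n : ℕ) :
    Integrable (fun ω => widthGrowth (colFamily (φ ω)) n) μ :=
  (integrable_const (2 * (n * gaussianAbsMoment))).mono'
    (measurable_widthGrowth hφ n).aestronglyMeasurable (ae_of_all _ fun ω => by
      rw [Real.norm_of_nonneg (widthGrowth_nonneg (φ ω) n)]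
      exact widthGrowth_le (φ ω) n)

theorem integrable_supportFun_left (hφ : ∀ x y, Measurable fun ω => φ ω x y) (x : Fin n → X)
    (u : Fin n → ℝ) : Integrable (fun ω => supportFun (evalSet (colFamily (φ ω)) x) u) μ :=
  (integrable_const (∑ i, |u i|)).mono'
    ((measurable_supportFun hφ x).comp measurable_prodMk_right).aestronglyMeasurable
    (ae_of_all _ fun ω => abs_supportFun_le (φ ω) x u)

/-- The support function of the expectation is at most the expectation of the support function:
a supremum of linear functions is convex. -/
theorem supportFun_expectation_le (hφ : ∀ x y, Measurable fun ω => φ ω x y) (x : Fin n → X)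
    (u : Fin n → ℝ) :
    supportFun (evalSet (colFamily (expectation μ φ)) x) u ≤
      ∫ ω, supportFun (evalSet (colFamily (φ ω)) x) u ∂μ := by
  cases isEmpty_or_nonempty Y
  · simp [supportFun_of_isEmpty]
  rw [supportFun_evalSet_colFamily]
  refine ciSup_le fun y => ?_
  have hint : ∀ i, Integrable (fun ω => (φ ω (x i) y : ℝ) * u i) μ := fun i =>
    ((integrable_const (1 : ℝ)).mono' (hφ (x i) y).subtype_val.aestronglyMeasurable
      (ae_of_all _ fun ω => by
        rw [Real.norm_of_nonneg (φ ω (x i) y).2.1]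
        exact (φ ω (x i) y).2.2)).mul_const _
  have h : (fun i => (expectation μ φ (x i) y : ℝ)) ⬝ᵥ u =
      ∫ ω, (fun i => (φ ω (x i) y : ℝ)) ⬝ᵥ u ∂μ := by
    simp only [dotProduct, expectation]
    rw [integral_finsetSum _ fun i _ => hint i]
    simp only [integral_mul_const]
  rw [h]
  exact integral_mono (integrable_finsetSum _ fun i _ => hint i)
    (integrable_supportFun_left μ hφ x u) fun ω => dotProduct_le_supportFun (φ ω) x u y

theorem width_expectation_le (hφ : ∀ x y, Measurable fun ω => φ ω x y) (x : Fin n → X)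
    (u : Fin n → ℝ) :
    width (evalSet (colFamily (expectation μ φ)) x) u ≤
      ∫ ω, width (evalSet (colFamily (φ ω)) x) u ∂μ := by
  simp only [width]
  rw [integral_add (integrable_supportFun_left μ hφ x u) (integrable_supportFun_left μ hφ x (-u))]
  exact add_le_add (supportFun_expectation_le μ hφ x u) (supportFun_expectation_le μ hφ x (-u))

theorem integrable_width_prod (hφ : ∀ x y, Measurable fun ω => φ ω x y) (x : Fin n → X) :
    Integrable (fun p : Ω × (Fin n → ℝ) => width (evalSet (colFamily (φ p.1)) x) p.2)
      (μ.prod (stdGaussianPi n)) :=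
  (((integrable_sum_abs n).const_mul 2).comp_snd μ).mono'
    (measurable_width hφ x).aestronglyMeasurable (ae_of_all _ fun p => by
      rw [Real.norm_of_nonneg (width_nonneg (φ p.1) x p.2)]
      exact width_le (φ p.1) x p.2)

theorem gaussianMeanWidth_expectation_le (hφ : ∀ x y, Measurable fun ω => φ ω x y)
    (x : Fin n → X) :
    gaussianMeanWidth (evalSet (colFamily (expectation μ φ)) x) ≤
      ∫ ω, gaussianMeanWidth (evalSet (colFamily (φ ω)) x) ∂μ := by
  have hprod := integrable_width_prod μ hφ x
  simp only [gaussianMeanWidth]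
  rw [integral_integral_swap (f := fun ω u => width (evalSet (colFamily (φ ω)) x) u) hprod]
  exact integral_mono (integrable_width _ x) hprod.integral_prod_right
    fun u => width_expectation_le μ hφ x u

theorem widthGrowth_expectation_le [Countable X] (hφ : ∀ x y, Measurable fun ω => φ ω x y)
    (n : ℕ) :
    widthGrowth (colFamily (expectation μ φ)) n ≤
      ∫ ω, widthGrowth (colFamily (φ ω)) n ∂μ := by
  refine Real.iSup_le (fun x => ?_) (integral_nonneg fun ω => widthGrowth_nonneg (φ ω) n)
  refine (gaussianMeanWidth_expectation_le μ hφ x).trans ?_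
  exact integral_mono_of_nonneg (ae_of_all _ fun ω => gaussianMeanWidth_nonneg (φ ω) x)
    (integrable_widthGrowth μ hφ n)
    (ae_of_all _ fun ω => gaussianMeanWidth_le_widthGrowth (φ ω) x)

end

/-! ### The mean width sees shattered sets -/

/-- If the columns shatter `{x₀, …, xₙ₋₁}` between `r` and `s`, then in every direction `u` the
columns picking out the points with `u i > 0` and with `u i ≤ 0` show that the width is at
least `(s - r) * ‖u‖₁`. -/
theorem le_width_of_shatters {X Y : Type*} {φ : X → Y → I} {r s : ℝ} {hrs : r < s} {n : ℕ}
    {x : Fin n → X} (hx : Function.Injective x)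
    (h : Shatters (levelClass (colFamily φ) r s hrs) (Finset.univ.map ⟨x, hx⟩)) (u : Fin n → ℝ) :
    (s - r) * ∑ i, |u i| ≤ width (evalSet (colFamily φ) x) u := by
  classical
  rw [shatters_levelClass_colFamily] at h
  have hsplit : ∀ p : Fin n → Prop, ∃ y, ∀ i, (p i → s ≤ (φ (x i) y : ℝ)) ∧
      (¬ p i → (φ (x i) y : ℝ) ≤ r) := fun p => by
    obtain ⟨y, h1, h0⟩ := h ((Finset.univ.filter p).map ⟨x, hx⟩)
      (Finset.map_subset_map.2 (Finset.filter_subset _ _))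
    refine ⟨y, fun i => ⟨fun hi => h1 _ ?_, fun hi => h0 _ ?_ ?_⟩⟩
    · simp [hi]
    · simp
    · simp [hi]
  obtain ⟨y, hy⟩ := hsplit fun i => 0 < u i
  obtain ⟨z, hz⟩ := hsplit fun i => ¬ 0 < u i
  have h1 := dotProduct_le_supportFun φ x u y
  have h2 := dotProduct_le_supportFun φ x (-u) z
  refine le_trans ?_ (add_le_add h1 h2)
  rw [dotProduct, dotProduct, ← Finset.sum_add_distrib, Finset.mul_sum]
  refine Finset.sum_le_sum fun i _ => ?_
  rw [Pi.neg_apply]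
  by_cases hi : 0 < u i
  · have a := (hy i).1 hi
    have b := (hz i).2 (not_not.2 hi)
    rw [abs_of_pos hi]
    nlinarith
  · have a := (hy i).2 hi
    have b := (hz i).1 hi
    rw [abs_of_nonpos (not_lt.1 hi)]
    nlinarith

theorem le_widthGrowth_of_shatters {X Y : Type*} [Countable Y] {φ : X → Y → I} {r s : ℝ}
    {hrs : r < s} {F : Finset X} (h : Shatters (levelClass (colFamily φ) r s hrs) F) :
    (s - r) * (F.card * gaussianAbsMoment) ≤ widthGrowth (colFamily φ) F.card := by
  let x : Fin F.card → X := fun i => F.equivFin.symm i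
  have hx : Function.Injective x := Subtype.val_injective.comp F.equivFin.symm.injective
  have hF : Finset.univ.map ⟨x, hx⟩ = F := by
    refine Finset.eq_of_subset_of_card_le (fun z hz => ?_) (by simp)
    obtain ⟨i, -, rfl⟩ := Finset.mem_map.1 hz
    exact (F.equivFin.symm i).2
  refine le_trans ?_ (gaussianMeanWidth_le_widthGrowth φ x)
  rw [← integral_sum_abs, ← integral_const_mul]
  exact integral_mono ((integrable_sum_abs _).const_mul _) (integrable_width φ x) fun u =>
    le_width_of_shatters hx (hF.symm ▸ h) u

/-! ### Sublinear growth of the mean width -/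

/-- The inequality `1 + t ≤ exp t` at `t = c ⟨a, u⟩ - M`, where `a` is the point of the net next to
a given column, bounds a maximum of Gaussian variables by a sum of exponentials, which has a
computable expectation. -/
theorem mul_supportFun_le {X Y : Type*} [Nonempty Y] {φ : X → Y → I} {n : ℕ} {x : Fin n → X}
    {𝓕 : Finset Y} {ε : ℝ}
    (h𝓕 : ∀ y, ∃ y' ∈ 𝓕, ∀ i, |(φ (x i) y : ℝ) - φ (x i) y'| ≤ ε) {c : ℝ} (hc : 0 ≤ c) (M : ℝ)
    (u : Fin n → ℝ) :
    c * supportFun (evalSet (colFamily φ) x) u ≤ c * (ε * ∑ i, |u i|) + (M - 1 +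
      ∑ y ∈ 𝓕, Real.exp (-M) * Real.exp (c * ((fun i => (φ (x i) y : ℝ)) ⬝ᵥ u))) := by
  rw [supportFun_evalSet_colFamily, Real.mul_iSup_of_nonneg hc]
  refine ciSup_le fun y => ?_
  obtain ⟨y', hy', hyy'⟩ := h𝓕 y
  have h1 : (fun i => (φ (x i) y : ℝ)) ⬝ᵥ u ≤ ε * ∑ i, |u i| + (fun i => (φ (x i) y' : ℝ)) ⬝ᵥ u := by
    have hsub : ((fun i => (φ (x i) y : ℝ)) - fun i => (φ (x i) y' : ℝ)) ⬝ᵥ u ≤ ε * ∑ i, |u i| :=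
      (le_abs_self _).trans (abs_dotProduct_le hyy' u)
    rw [sub_dotProduct] at hsub
    linarith
  have h2 := mul_le_mul_of_nonneg_left h1 hc
  have h3 := Finset.single_le_sum (f := fun y =>
    Real.exp (-M) * Real.exp (c * ((fun i => (φ (x i) y : ℝ)) ⬝ᵥ u)))
    (fun y _ => by positivity) hy'
  have h4 := Real.add_one_le_exp (-M + c * ((fun i => (φ (x i) y' : ℝ)) ⬝ᵥ u))
  rw [Real.exp_add] at h4
  linarith

instance : (gaussianReal 0 1).IsNegInvariant :=
  ⟨by simpa [Measure.neg] using gaussianReal_map_neg (μ := 0) (v := 1)⟩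

theorem gaussianMeanWidth_eq_two_mul {X Y : Type*} [Countable Y] (φ : X → Y → I) {n : ℕ}
    (x : Fin n → X) :
    gaussianMeanWidth (evalSet (colFamily φ) x) =
      2 * ∫ u, supportFun (evalSet (colFamily φ) x) u ∂(stdGaussianPi n) := by
  simp only [gaussianMeanWidth, width]
  rw [integral_add (integrable_supportFun φ x) (integrable_supportFun_neg φ x),
    integral_neg_eq_self (fun u => supportFun (evalSet (colFamily φ) x) u), two_mul]

theorem gaussianMeanWidth_le_of_net {X Y : Type*} [Countable Y] [Nonempty Y] {φ : X → Y → I}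
    {n : ℕ} {x : Fin n → X} {𝓕 : Finset Y} {ε : ℝ}
    (h𝓕 : ∀ y, ∃ y' ∈ 𝓕, ∀ i, |(φ (x i) y : ℝ) - φ (x i) y'| ≤ ε) {B : ℕ} (hB : 𝓕.card < B)
    {c : ℝ} (hc : 0 < c) :
    gaussianMeanWidth (evalSet (colFamily φ) x) ≤
      2 * (ε * (n * gaussianAbsMoment) + (Real.log B / c + n * (c / 2))) := by
  have hB0 : (0 : ℝ) < B := by exact_mod_cast (Nat.zero_le _).trans_lt hB
  -- With this `M`, the expectation of each of the exponentials is at most `1 / B`.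
  set M : ℝ := Real.log B + n * (c ^ 2 / 2) with hM
  have hexp : ∀ y, Integrable (fun u => Real.exp (-M) *
      Real.exp (c * ((fun i => (φ (x i) y : ℝ)) ⬝ᵥ u))) (stdGaussianPi n) := fun y =>
    (integrable_exp_mul_dotProduct c _).const_mul _
  have hsum := integrable_finsetSum 𝓕 fun y _ => hexp y
  have hl1 := (integrable_sum_abs n).const_mul ε
  have h := integral_mono ((integrable_supportFun φ x).const_mul c)
    ((hl1.const_mul c).add ((integrable_const (M - 1)).add hsum))
    fun u => mul_supportFun_le h𝓕 hc.le M u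
  rw [integral_const_mul, integral_add' (hl1.const_mul c) ((integrable_const _).add hsum),
    integral_add' (integrable_const _) hsum, integral_const_mul, integral_const_mul,
    integral_sum_abs, integral_finsetSum _ fun y _ => hexp y] at h
  have hone : ∀ y ∈ 𝓕, ∫ u, Real.exp (-M) *
      Real.exp (c * ((fun i => (φ (x i) y : ℝ)) ⬝ᵥ u)) ∂(stdGaussianPi n) ≤ (B : ℝ)⁻¹ :=
    fun y _ => by
      rw [integral_const_mul]
      refine (mul_le_mul_of_nonneg_left
        (integral_exp_mul_dotProduct_le c fun i => φ (x i) y) (Real.exp_pos _).le).trans ?_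
      rw [← Real.exp_add, hM, neg_add, add_assoc, neg_add_cancel, add_zero, Real.exp_neg,
        Real.exp_log hB0]
  have hle : ∑ y ∈ 𝓕, ∫ u, Real.exp (-M) *
      Real.exp (c * ((fun i => (φ (x i) y : ℝ)) ⬝ᵥ u)) ∂(stdGaussianPi n) ≤ 1 := by
    refine (Finset.sum_le_sum hone).trans ?_
    rw [Finset.sum_const, nsmul_eq_mul, ← div_eq_mul_inv, div_le_one hB0]
    exact_mod_cast hB.le
  have h2 : c * ∫ u, supportFun (evalSet (colFamily φ) x) u ∂(stdGaussianPi n) ≤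
      c * (ε * (n * gaussianAbsMoment) + (Real.log B / c + n * (c / 2))) := by
    have h3 : c * (ε * (n * gaussianAbsMoment) + (Real.log B / c + n * (c / 2))) =
        c * (ε * (n * gaussianAbsMoment)) + M := by
      rw [hM]
      field_simp
    have h4 : ∫ _u : Fin n → ℝ, (M - 1) ∂(stdGaussianPi n) = M - 1 := by simp
    rw [h3]
    linarith
  rw [gaussianMeanWidth_eq_two_mul]
  exact mul_le_mul_of_nonneg_left (le_of_mul_le_mul_left h2 hc) zero_le_two

/-- Uniform dependence makes the mean width `o(n)`, uniformly in `ω`. -/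
theorem UniformlyDependent.exists_widthGrowth_le {Ω X Y : Type*} [Countable Y] [Nonempty Y]
    {φ : Ω → X → Y → I} (h : UniformlyDependent φ) {δ : ℝ} (hδ : 0 < δ) :
    ∃ n : ℕ, 0 < n ∧ ∀ ω, widthGrowth (colFamily (φ ω)) n ≤ δ * n := by
  have hm := gaussianAbsMoment_pos
  -- `K`, the parameter `c = δ / 3` and `n` make each of the three terms of the bound in
  -- `gaussianMeanWidth_le_of_net` at most `δ n / 3`.
  obtain ⟨K, hK⟩ := exists_nat_gt (12 * gaussianAbsMoment / δ)
  have hK0' : (0 : ℝ) < K := lt_trans (by positivity) hK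
  have hK0 : 0 < K := by exact_mod_cast hK0'
  obtain ⟨d, hd⟩ := h (1 / K) (by positivity)
  obtain ⟨n, hn, hlog⟩ := exists_log_netBound_le d hK0 (η := δ ^ 2 / 18) (by positivity)
  refine ⟨n, hn, fun ω => Real.iSup_le (fun x => ?_) (by positivity)⟩
  obtain ⟨𝓕, hcard, hnet⟩ := exists_net_colFamily (φ := φ ω) hK0 (fun k hk => by
    refine hd (k / K) (by positivity) ?_ ω
    rw [le_sub_iff_add_le, ← add_div, div_le_one hK0']
    exact_mod_cast hk) x
  refine (gaussianMeanWidth_le_of_net hnet hcard (c := δ / 3) (by positivity)).trans ?_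
  have h1 : 2 / (K : ℝ) * (n * gaussianAbsMoment) ≤ δ / 6 * n := by
    rw [div_lt_iff₀ hδ] at hK
    rw [div_mul_eq_mul_div, div_le_iff₀ hK0']
    have := mul_le_mul_of_nonneg_right hK.le (n.cast_nonneg (α := ℝ))
    linarith
  have h2 : Real.log (netBound d K n) / (δ / 3) ≤ δ / 6 * n := by
    rw [div_le_iff₀ (by positivity)]
    linarith
  linarith

theorem UniformlyDependent.isVCClass_expectation {Ω X Y : Type*} [MeasurableSpace Ω]
    {μ : Measure Ω} [IsProbabilityMeasure μ] [Countable X] [Countable Y] {φ : Ω → X → Y → I}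
    (hφ : ∀ x y, Measurable fun ω => φ ω x y) (h : UniformlyDependent φ) :
    IsVCClass (colFamily (expectation μ φ)) := fun r s hrs _ _ => by
  rw [vcIndex_lt_top_iff]
  by_contra! hsh
  have : Nonempty Y := by
    obtain ⟨F, -, hF⟩ := hsh 0
    obtain ⟨y, -⟩ := shatters_levelClass_colFamily.1 hF ∅ (Finset.empty_subset F)
    exact ⟨y⟩
  have hpos : 0 < (s - r) * gaussianAbsMoment := mul_pos (sub_pos.2 hrs) gaussianAbsMoment_pos
  obtain ⟨n, hn, hle⟩ := h.exists_widthGrowth_le (half_pos hpos)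
  obtain ⟨F, rfl, hF⟩ := hsh n
  have h1 := (le_widthGrowth_of_shatters hF).trans (widthGrowth_expectation_le μ hφ F.card)
  have h2 : ∫ ω, widthGrowth (colFamily (φ ω)) F.card ∂μ ≤
      (s - r) * gaussianAbsMoment / 2 * F.card := by
    simpa using integral_mono (integrable_widthGrowth μ hφ F.card)
      (integrable_const (μ := μ) ((s - r) * gaussianAbsMoment / 2 * F.card)) hle
  have hn' : (0 : ℝ) < F.card := by exact_mod_cast hn
  nlinarith [mul_pos hpos hn']

end RandomVC

theorem mainTheorem3 {Ω X Y : Type*} [MeasurableSpace Ω] (μ : Measure Ω) [IsProbabilityMeasure μ]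
    [Countable X] [Countable Y] (φ : Ω → X → Y → I)
    (hφ : ∀ (x : X) (y : Y), Measurable fun ω => φ ω x y) :
    (∀ n : ℕ,
      Measurable (fun ω => RandomVC.widthGrowth (RandomVC.colFamily (φ ω)) n) ∧
      Integrable (fun ω => RandomVC.widthGrowth (RandomVC.colFamily (φ ω)) n) μ ∧
      RandomVC.widthGrowth (RandomVC.colFamily (RandomVC.expectation μ φ)) n ≤
        ∫ ω, RandomVC.widthGrowth (RandomVC.colFamily (φ ω)) n ∂μ) ∧
    (RandomVC.UniformlyDependent φ → RandomVC.IsDependent (RandomVC.expectation μ φ)) := by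
  refine ⟨fun n => ⟨RandomVC.measurable_widthGrowth hφ n, RandomVC.integrable_widthGrowth μ hφ n,
    RandomVC.widthGrowth_expectation_le μ hφ n⟩, fun h => ?_⟩
  have hvc := h.isVCClass_expectation (μ := μ) hφ
  exact ⟨hvc, hvc.rowFamily⟩
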